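/- Consider a system of $n$ sporadic implicit-deadline DAG tasks $\tau_1,\dots,\tau_n$ on $M\ge 1$ identical processors. Each task $\tau_i$ has a period $T_i>0$ and a nonempty set of directed acyclic graphs whose nodes (subtasks) carry nonnegative execution times. $\tau_i$ releases a finite or infinite sequence of jobs, any two at least $T_i$ time units apart. Each job executes one of the DAGs of $\tau_i$ (different jobs may execute different ones; for a conditional DAG task, the set consists of the DAGs arising from the possible outcomes of the conditions) and has its deadline $T_i$ time units after its release. Every DAG of $\tau_i$ has total execution time (sum over its nodes) at most $C_i$ and critical-path length (largest total execution time along a directed path) at most $\Psi_i$; put $U_i=C_i/T_i$. Successive jobs of the same task execute in sequence, and a subtask is ready once its job has been released, the earlier jobs of its task are finished, and all its predecessors in the DAG are finished. Let the tasks be indexed by rate-monotonic priority, $T_1\le T_2\le\dots\le T_n$, a smaller index meaning higher priority. Preemptive global rate-monotonic scheduling executes, at each time, at most $M$ ready subtasks (each on one processor), and a ready subtask is not executed only if all $M$ processors execute subtasks of tasks with the same or higher priority. A task is schedulable if, for every legal sequence of jobs and every schedule so produced, all of its jobs finish by their deadlines. Let $1\le k\le n$, and suppose that the higher-priority tasks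 $\tau_1,\dots,\tau_{k-1}$ are schedulable under global rate-monotonic scheduling on $M$ processors. If $$\Bigl(\frac{\Psi_k}{T_k}+2\Bigr)\prod_{j=1}^{k}\Bigl(\frac{U_j}{M}+1\Bigr)\le 3 \qquad\text{or}\qquad \sum_{j=1}^{k}\frac{U_j}{M}\le \ln\frac{3}{\frac{\Psi_k}{T_k}+2},$$ then $\tau_k$ is schedulable under global rate-monotonic scheduling on $M$ processors. -/

import Mathlib

open MeasureTheory

/-- A directed acyclic graph of subtasks. The nodes are `Fin size`, `edge u v` says that
`v` depends on `u`, and `wt v` is the execution time of the subtask `v`. -/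
structure Dag where
  size : ℕ
  edge : Fin size → Fin size → Prop
  acyclic : ∀ v, ¬ Relation.TransGen edge v v
  wt : Fin size → ℝ
  wt_nonneg : ∀ v, 0 ≤ wt v

namespace Dag

/-- The total execution time (work) of a DAG. -/
def work (G : Dag) : ℝ := ∑ v, G.wt v

/-- The lengths of the directed paths of a DAG: a path is a list of nodes in which consecutive
nodes are joined by an edge, its length is the sum of the execution times of its nodes. -/
def pathLengths (G : Dag) : Set ℝ :=
  {x | ∃ p : List (Fin G.size), p.IsChain G.edge ∧ x = (p.map G.wt).sum}

/-- The critical-path length of a DAG: the largest length of a directed path. -/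
noncomputable def critLen (G : Dag) : ℝ := sSup G.pathLengths

theorem pathLengths_nonempty (G : Dag) : G.pathLengths.Nonempty :=
  ⟨0, [], by simp, by simp⟩

/-- Every path length is at most the work, so the supremum in `critLen` is a genuine one. -/
theorem le_work_of_mem_pathLengths (G : Dag) {x : ℝ} (hx : x ∈ G.pathLengths) :
    x ≤ G.work := by
  obtain ⟨p, hp, rfl⟩ := hx
  have h1 : p.Pairwise (Relation.TransGen G.edge) :=
    List.isChain_iff_pairwise.mp (hp.imp fun _ _ h => Relation.TransGen.single h)
  have h2 : p.Nodup := h1.imp (S := (· ≠ ·)) (fun {a b} h e => G.acyclic a (by rw [← e] at h; exact h))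
  rw [← List.sum_toFinset G.wt h2]
  exact Finset.sum_le_sum_of_subset_of_nonneg (Finset.subset_univ _)
    (fun v _ _ => G.wt_nonneg v)

theorem pathLengths_bddAbove (G : Dag) : BddAbove G.pathLengths :=
  ⟨G.work, fun _ hx => G.le_work_of_mem_pathLengths hx⟩

end Dag

/-- A sporadic DAG task with implicit deadline: its execution patterns are a nonempty set `dags`
of DAGs, and each job executes one of them (the structure may differ from job to job; for a
conditional DAG task, `dags` is the set of the DAGs that arise from the possible outcomes of the
conditions). `C` bounds the total execution time and `Psi` the critical-path length of every
pattern. `T` is the minimum inter-release time and also the relative deadline. -/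
structure DagTask where
  T : ℝ
  T_pos : 0 < T
  dags : Set Dag
  dags_nonempty : dags.Nonempty
  C : ℝ
  work_le : ∀ G ∈ dags, G.work ≤ C
  Psi : ℝ
  critLen_le : ∀ G ∈ dags, G.critLen ≤ Psi

/-- The utilization of a task. -/
noncomputable def DagTask.U (τ : DagTask) : ℝ := τ.C / τ.T

/-- A legal sequence of jobs of the task system `τ`. Task `i` releases the jobs with indices in
`jobs i` (finitely or infinitely many, possibly none); two jobs of task `i` are released at least
`T` time units apart, and each job executes one of the DAGs of its task. -/
structure JobSequence {n : ℕ} (τ : Fin n → DagTask) where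
  jobs : Fin n → Set ℕ
  release : Fin n → ℕ → ℝ
  dag : Fin n → ℕ → Dag
  separation : ∀ i, ∀ j ∈ jobs i, ∀ j' ∈ jobs i, j < j' →
    release i j + (τ i).T ≤ release i j'
  dag_mem : ∀ i, ∀ j ∈ jobs i, dag i j ∈ (τ i).dags

/-- A subtask: the node `node` of the `job`-th job of task `task`. -/
structure Subtask {n : ℕ} {τ : Fin n → DagTask} (J : JobSequence τ) where
  task : Fin n
  job : ℕ
  node : Fin (J.dag task job).size

section Scheduling

variable {n : ℕ} {τ : Fin n → DagTask} {J : JobSequence τ}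

/-- A schedule tells which subtasks are being executed at each time. The amount of service that
the subtask `x` has received before time `t`. -/
noncomputable def service (run : ℝ → Finset (Subtask J)) (x : Subtask J) (t : ℝ) : ENNReal :=
  volume {s : ℝ | s < t ∧ x ∈ run s}

/-- The subtask `x` has been completely executed by time `t`. -/
def Finished (run : ℝ → Finset (Subtask J)) (x : Subtask J) (t : ℝ) : Prop :=
  ENNReal.ofReal ((J.dag x.task x.job).wt x.node) ≤ service run x t

/-- The `j`-th job of task `i` has been completely executed by time `t`. -/
def JobFinished (run : ℝ → Finset (Subtask J)) (i : Fin n) (j : ℕ) (t : ℝ) : Prop :=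
  ∀ v : Fin (J.dag i j).size, Finished run ⟨i, j, v⟩ t

/-- The subtask `x` is ready at time `t`: its job has been released, all earlier jobs of the same
task are finished, all its (direct and indirect) predecessors in the DAG are finished, and it is
not finished itself. -/
def Ready (run : ℝ → Finset (Subtask J)) (x : Subtask J) (t : ℝ) : Prop :=
  x.job ∈ J.jobs x.task ∧ J.release x.task x.job ≤ t ∧
  (∀ j ∈ J.jobs x.task, j < x.job → JobFinished run x.task j t) ∧
  (∀ u, Relation.TransGen (J.dag x.task x.job).edge u x.node →
    Finished run ⟨x.task, x.job, u⟩ t) ∧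
  ¬ Finished run x t

/-- `run` is a schedule of the jobs `J` produced by preemptive global fixed-priority scheduling
on `M` identical processors, tasks with smaller index having higher priority: at each time at
most `M` subtasks are executed, all of them ready, and a ready subtask has to wait only if all
the processors execute subtasks of priority at least as high. -/
structure IsGlobalFixedPriority (M : ℕ) (run : ℝ → Finset (Subtask J)) : Prop where
  measurable : ∀ x, MeasurableSet {t : ℝ | x ∈ run t}
  card_le : ∀ t, (run t).card ≤ M
  ready : ∀ t, ∀ x ∈ run t, Ready run x t
  dispatch : ∀ t x, Ready run x t → x ∉ run t →
    (run t).card = M ∧ ∀ y ∈ run t, y.task ≤ x.task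

end Scheduling

/-- The priority order given by the indices is rate-monotonic. -/
def IsRateMonotonic {n : ℕ} (τ : Fin n → DagTask) : Prop :=
  ∀ i j, i ≤ j → (τ i).T ≤ (τ j).T

/-- Task `i` is schedulable on `M` processors: in every schedule of every legal job sequence, all
jobs of task `i` are finished by their deadlines. -/
def Schedulable {n : ℕ} (τ : Fin n → DagTask) (M : ℕ) (i : Fin n) : Prop :=
  ∀ (J : JobSequence τ) (run : ℝ → Finset (Subtask J)), IsGlobalFixedPriority M run →
    ∀ j ∈ J.jobs i, JobFinished run i j (J.release i j + (τ i).T)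

/-! Suppose a job of `τ k` misses its deadline, and take the window of length `t ≤ T k` from its
release. At each instant either all `M` processors serve priority at least `k`, or every ready
subtask of the job runs and its remaining critical path shrinks. Hence `t` is at most `Psi k` plus
the relevant work divided by `M` (`volume_window_le`). Schedulability of the higher tasks limits
their carry-in to one job each, so `⌈t / T i⌉ + 1` jobs of task `i` suffice
(`le_demand_of_not_jobFinished`). This holds for all `t ≤ T k`. Testing it at the last multiple of
each `T i` not exceeding `T k` gives a triangular system of inequalities that multiplies up to the
hyperbolic bound (`add_sum_mul_le_mul_prod`, `three_mul_le_of_forall_le_demand`), contradicting the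
first test. The second test implies the first by `u + 1 ≤ exp u`. -/

theorem Dag.wellFounded_edge (G : Dag) : WellFounded G.edge := by
  have : Std.Irrefl (Relation.TransGen G.edge) := ⟨G.acyclic⟩
  exact Subrelation.wf (fun {a b} h => Relation.TransGen.single h)
    (Finite.wellFounded_of_trans_of_irrefl (Relation.TransGen G.edge))

theorem Dag.sum_le_critLen (G : Dag) {p : List (Fin G.size)} (hp : p.IsChain G.edge) :
    (p.map G.wt).sum ≤ G.critLen :=
  le_csSup G.pathLengths_bddAbove ⟨p, hp, rfl⟩

theorem Dag.critLen_nonneg (G : Dag) : 0 ≤ G.critLen := by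
  simpa using G.sum_le_critLen (p := []) (by simp)

theorem DagTask.Psi_nonneg (τ : DagTask) : 0 ≤ τ.Psi :=
  let ⟨G, hG⟩ := τ.dags_nonempty
  G.critLen_nonneg.trans (τ.critLen_le G hG)

theorem DagTask.C_nonneg (τ : DagTask) : 0 ≤ τ.C :=
  let ⟨G, hG⟩ := τ.dags_nonempty
  (Finset.sum_nonneg fun v _ => G.wt_nonneg v).trans (τ.work_le G hG)

theorem DagTask.U_nonneg (τ : DagTask) : 0 ≤ τ.U :=
  div_nonneg τ.C_nonneg τ.T_pos.le

/-- Points of an open interval of length `L` that are pairwise at least `T` apart number at most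
`⌈L / T⌉`. -/
theorem card_le_ceil_of_separated {S : Set ℕ} {f : ℕ → ℝ} {T a L : ℝ} (hT : 0 < T)
    (hsep : ∀ j ∈ S, ∀ j' ∈ S, j < j' → f j + T ≤ f j')
    (hlow : ∀ j ∈ S, a < f j) (hhigh : ∀ j ∈ S, f j < a + L) :
    ∃ F : Finset ℕ, (F : Set ℕ) = S ∧ F.card ≤ ⌈L / T⌉₊ := by
  have hnn : ∀ j ∈ S, 0 ≤ (f j - a) / T := fun j hj =>
    div_nonneg (sub_nonneg.2 (hlow j hj).le) hT.le
  -- After scaling by `T` the points are at least 1 apart, so their floors are distinct.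
  have hlt : ∀ j ∈ S, ∀ j' ∈ S, j < j' → ⌊(f j - a) / T⌋₊ < ⌊(f j' - a) / T⌋₊ := by
    intro j hj j' hj' h
    rw [← Nat.succ_le_iff, Nat.succ_eq_add_one, ← Nat.floor_add_one (hnn j hj)]
    apply Nat.floor_mono
    rw [div_add_one hT.ne', div_le_div_iff_of_pos_right hT]
    linarith [hsep j hj j' hj' h]
  have hinj : Set.InjOn (fun j => ⌊(f j - a) / T⌋₊) S := by
    intro j hj j' hj' h
    rcases lt_trichotomy j j' with hl | hl | hl
    · exact absurd h (hlt j hj j' hj' hl).ne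
    · exact hl
    · exact absurd h (hlt j' hj' j hj hl).ne'
  have hmaps : Set.MapsTo (fun j => ⌊(f j - a) / T⌋₊) S (Finset.range ⌈L / T⌉₊) := by
    intro j hj
    simp only [Finset.coe_range, Set.mem_Iio, Nat.lt_ceil]
    refine (Nat.floor_le (hnn j hj)).trans_lt ?_
    rw [div_lt_div_iff_of_pos_right hT]
    linarith [hhigh j hj]
  have hfin : S.Finite := Set.Finite.of_injOn hmaps hinj (Finset.finite_toSet _)
  refine ⟨hfin.toFinset, by simp, ?_⟩
  have := Finset.card_le_card_of_injOn (s := hfin.toFinset) (t := Finset.range ⌈L / T⌉₊)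
    (fun j => ⌊(f j - a) / T⌋₊) (by simpa using hmaps) (by simpa using hinj)
  simpa using this

/-! ### Processor time and time demand in a schedule -/

section Scheduling

variable {n : ℕ} {τ : Fin n → DagTask} {J : JobSequence τ} {run : ℝ → Finset (Subtask J)}

theorem service_mono (x : Subtask J) : Monotone (service run x) := fun _ _ h =>
  measure_mono fun _ hr => ⟨hr.1.trans_le h, hr.2⟩

theorem Finished.mono {x : Subtask J} {s t : ℝ} (h : Finished run x s) (hst : s ≤ t) :
    Finished run x t :=
  le_trans h (service_mono x hst)

theorem JobFinished.mono {i : Fin n} {j : ℕ} {s t : ℝ} (h : JobFinished run i j s)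
    (hst : s ≤ t) : JobFinished run i j t :=
  fun v => (h v).mono hst

namespace IsGlobalFixedPriority

variable {M : ℕ}

/-- No subtask receives more service than its execution time. -/
theorem service_le (hrun : IsGlobalFixedPriority M run) (x : Subtask J) (t : ℝ) :
    service run x t ≤ ENNReal.ofReal ((J.dag x.task x.job).wt x.node) := by
  set w := ENNReal.ofReal ((J.dag x.task x.job).wt x.node) with hw
  set R : Set ℝ := {s | s < t ∧ x ∈ run s} with hR
  have hlt : ∀ s ∈ R, service run x s < w := fun s hs =>
    not_le.1 (hrun.ready s x hs.2).2.2.2.2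
  rcases R.eq_empty_or_nonempty with h0 | hne
  · have : service run x t = volume R := rfl
    simp [this, h0]
  have hbdd : BddAbove R := ⟨t, fun s hs => hs.1.le⟩
  -- Service is still below `w` at every running time; approach the last such time from below, its
  -- endpoint being null.
  obtain ⟨u, hu, hua, hlim⟩ := exists_seq_strictMono_tendsto (sSup R)
  have hsub : R ⊆ (⋃ m, {s | s < u m ∧ x ∈ run s}) ∪ {sSup R} := by
    intro s hs
    rcases (le_csSup hbdd hs).lt_or_eq with h | h
    · obtain ⟨m, hm⟩ := (hlim.eventually (lt_mem_nhds h)).exists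
      exact Or.inl (Set.mem_iUnion.2 ⟨m, hm, hs.2⟩)
    · exact Or.inr h
  have hmono : Monotone fun m => {s | s < u m ∧ x ∈ run s} := fun m m' h s hs =>
    ⟨hs.1.trans_le (hu.monotone h), hs.2⟩
  calc service run x t = volume R := rfl
    _ ≤ volume (⋃ m, {s | s < u m ∧ x ∈ run s}) + volume {sSup R} :=
        (measure_mono hsub).trans (measure_union_le _ _)
    _ = ⨆ m, volume {s | s < u m ∧ x ∈ run s} := by
        rw [hmono.measure_iUnion]; simp
    _ ≤ w := iSup_le fun m => by
        obtain ⟨s, hs, hms⟩ := exists_lt_of_lt_csSup hne (hua m)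
        exact (service_mono x hms.le).trans (hlt s hs).le

/-- If in a set `I` of times every ready subtask of a job is executed, then the times of `I` at
which the job is not finished have measure at most the critical-path length of the job. -/
theorem volume_unfinished_le_critLen (hrun : IsGlobalFixedPriority M run) {i : Fin n} {j : ℕ}
    {I : Set ℝ} (hj : j ∈ J.jobs i) (hrel : ∀ s ∈ I, J.release i j ≤ s)
    (hprev : ∀ s ∈ I, ∀ j' ∈ J.jobs i, j' < j → JobFinished run i j' s)
    (hexec : ∀ s ∈ I, ∀ v, Ready run ⟨i, j, v⟩ s → (⟨i, j, v⟩ : Subtask J) ∈ run s)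
    {e : ℝ} (hI : ∀ s ∈ I, s < e) (hunf : ¬ JobFinished run i j e) :
    volume I ≤ ENNReal.ofReal (J.dag i j).critLen := by
  set G := J.dag i j with hG
  -- Times of `I` at which `v` or an ancestor is unfinished. These are initial segments of `I`,
  -- hence nested, so a union over predecessors costs a supremum and not a sum.
  let Q : Fin G.size → Set ℝ := fun v =>
    {s | s ∈ I ∧ ∃ u, Relation.ReflTransGen G.edge u v ∧ ¬ Finished run ⟨i, j, u⟩ s}
  have hdown : ∀ v, ∀ s ∈ Q v, ∀ s' ∈ I, s' ≤ s → s' ∈ Q v := by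
    rintro v s ⟨_, u, hu, hf⟩ s' hs' hle
    exact ⟨hs', u, hu, fun h => hf (h.mono hle)⟩
  have hnest : ∀ u v, Q u ⊆ Q v ∨ Q v ⊆ Q u := by
    intro u v
    by_contra! hcon
    obtain ⟨⟨s, hs, hs'⟩, ⟨s₂, hs₂, hs₂'⟩⟩ :=
      And.imp Set.not_subset.1 Set.not_subset.1 hcon
    rcases le_total s s₂ with h | h
    · exact hs' (hdown v s₂ hs₂ s hs.1 h)
    · exact hs₂' (hdown u s hs s₂ hs₂.1 h)
  have hstep : ∀ v, volume (Q v) ≤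
      (⨆ u : {u // G.edge u v}, volume (Q u)) + ENNReal.ofReal (G.wt v) := by
    intro v
    have hsub : Q v ⊆ (⋃ u : {u // G.edge u v}, Q u) ∪
        {s | s < e ∧ (⟨i, j, v⟩ : Subtask J) ∈ run s} := by
      rintro s ⟨hs, u, hu, hf⟩
      by_cases hp : ∃ u, Relation.TransGen G.edge u v ∧ ¬ Finished run ⟨i, j, u⟩ s
      · obtain ⟨u', hu', hf'⟩ := hp
        obtain ⟨w, hw, hwv⟩ := Relation.TransGen.tail'_iff.1 hu'
        exact Or.inl (Set.mem_iUnion.2 ⟨⟨w, hwv⟩, hs, u', hw, hf'⟩)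
      · push Not at hp
        have huv : u = v := by
          rcases Relation.reflTransGen_iff_eq_or_transGen.1 hu with h | h
          · exact h.symm
          · exact absurd (hp u h) hf
        subst huv
        exact Or.inr ⟨hI s hs, hexec s hs u ⟨hj, hrel s hs, hprev s hs, hp, hf⟩⟩
    have hdir : Directed (· ⊆ ·) fun u : {u // G.edge u v} => Q u := by
      intro u u'
      rcases hnest u u' with h | h
      · exact ⟨u', h, subset_rfl⟩
      · exact ⟨u, subset_rfl, h⟩
    calc volume (Q v) ≤ volume (⋃ u : {u // G.edge u v}, Q u) + service run ⟨i, j, v⟩ e :=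
          (measure_mono hsub).trans (measure_union_le _ _)
      _ ≤ _ := by
          rw [hdir.measure_iUnion]
          gcongr
          exact hrun.service_le ⟨i, j, v⟩ e
  have hwt : ∀ p : List (Fin G.size), 0 ≤ (p.map G.wt).sum := fun p =>
    List.sum_nonneg (by simpa using fun a _ => G.wt_nonneg a)
  -- The path `q` below `v` is carried along, so that the induction on predecessors assembles a
  -- whole chain.
  have key : ∀ v, ∀ q : List (Fin G.size), (v :: q).IsChain G.edge →
      volume (Q v) + ENNReal.ofReal (q.map G.wt).sum ≤ ENNReal.ofReal G.critLen := by
    intro v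
    induction v using G.wellFounded_edge.induction with
    | _ v ih =>
      intro q hq
      have hsum : ENNReal.ofReal (((v :: q).map G.wt).sum) =
          ENNReal.ofReal (G.wt v) + ENNReal.ofReal (q.map G.wt).sum := by
        rw [List.map_cons, List.sum_cons, ENNReal.ofReal_add (G.wt_nonneg v) (hwt q)]
      calc volume (Q v) + ENNReal.ofReal (q.map G.wt).sum
          ≤ (⨆ u : {u // G.edge u v}, volume (Q u)) +
              ENNReal.ofReal (((v :: q).map G.wt).sum) := by
            rw [hsum, ← add_assoc]
            gcongr
            exact hstep v
        _ ≤ ENNReal.ofReal G.critLen := by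
            rcases isEmpty_or_nonempty {u // G.edge u v} with hem | hne
            · rw [iSup_of_empty]
              simpa using ENNReal.ofReal_le_ofReal (G.sum_le_critLen hq)
            · rw [ENNReal.iSup_add]
              exact iSup_le fun u => ih u u.2 (v :: q) (List.isChain_cons_cons.2 ⟨u.2, hq⟩)
  obtain ⟨v, hv⟩ := not_forall.1 hunf
  have hsub : I ⊆ Q v := fun s hs => ⟨hs, v, .refl, fun h => hv (h.mono (hI s hs).le)⟩
  simpa using (measure_mono hsub).trans (le_add_right le_rfl |>.trans (key v [] (by simp)))

/-- If in a set `W` of times only jobs `j ∈ N i` of the tasks `i ≤ k` are executed among the tasks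
of priority at least that of `k`, and a job of task `k` is not finished by the end of `W`, then
the length of `W` is at most the critical-path length of this job plus the `M`-th part of the
work of all these jobs. -/
theorem volume_window_le (hrun : IsGlobalFixedPriority M run) (hM : 0 < M) {k : Fin n} {j : ℕ}
    {r e : ℝ} (hj : j ∈ J.jobs k) (hrel : J.release k j ≤ r)
    (hprev : ∀ j' ∈ J.jobs k, j' < j → JobFinished run k j' r)
    (hunf : ¬ JobFinished run k j e) (N : Fin n → Finset ℕ)
    (hN : ∀ s ∈ Set.Ico r e, ∀ y ∈ run s, y.task ≤ k → y.job ∈ N y.task) :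
    e - r ≤ (J.dag k j).critLen + (∑ i ∈ Finset.Iic k, ∑ j' ∈ N i, (J.dag i j').work) / M := by
  classical
  let φ : (Σ i : Fin n, Σ j : ℕ, Fin (J.dag i j).size) ↪ Subtask J :=
    ⟨fun x => ⟨x.1, x.2.1, x.2.2⟩, by
      rintro ⟨i, j, v⟩ ⟨i', j', v'⟩ h
      simp only [Subtask.mk.injEq] at h
      obtain ⟨rfl, rfl, h⟩ := h
      simpa using h⟩
  let Y : Finset (Subtask J) :=
    ((Finset.Iic k).sigma fun i => (N i).sigma fun _ => Finset.univ).map φ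
  have hY : ∀ y : Subtask J, y.task ≤ k → y.job ∈ N y.task → y ∈ Y := by
    rintro ⟨i, j, v⟩ h1 h2
    exact Finset.mem_map.2 ⟨⟨i, j, v⟩, by simpa using ⟨h1, h2⟩, rfl⟩
  have hYsum : ∑ y ∈ Y, (J.dag y.task y.job).wt y.node =
      ∑ i ∈ Finset.Iic k, ∑ j' ∈ N i, (J.dag i j').work := by
    simp only [Y, Finset.sum_map, Finset.sum_sigma]
    rfl
  let W : Set ℝ := Set.Ico r e
  -- `g` counts the processors serving `Y`; on `E` all `M` do, and Markov's inequality bounds the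
  -- measure of `W ∩ E`.
  let g : ℝ → ENNReal := fun s => ∑ y ∈ Y, Set.indicator {s | y ∈ run s} 1 s
  have hg : Measurable g := Finset.measurable_sum _ fun y _ =>
    measurable_one.indicator (hrun.measurable y)
  have hgY : ∀ s, (∀ y ∈ run s, y ∈ Y) → g s = (run s).card := by
    intro s hs
    have : g s = ∑ y ∈ Y, if y ∈ run s then 1 else 0 := by
      simp only [g, Set.indicator_apply, Set.mem_ofPred_eq, Pi.one_apply]
    rw [this, Finset.sum_ite_mem, Finset.inter_eq_right.2 hs]
    simp
  let E : Set ℝ := {s | (M : ENNReal) ≤ g s}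
  have hbusy : (M : ENNReal) * volume (W ∩ E) ≤
      ENNReal.ofReal (∑ y ∈ Y, (J.dag y.task y.job).wt y.node) := by
    have hE : MeasurableSet E := hg measurableSet_Ici
    have h1 : (M : ENNReal) * volume.restrict W E ≤ ∫⁻ s in W, g s :=
      mul_meas_ge_le_lintegral hg _
    rw [Measure.restrict_apply hE, Set.inter_comm] at h1
    refine h1.trans ?_
    rw [lintegral_finsetSum _ fun y _ => measurable_one.indicator (hrun.measurable y),
      ENNReal.ofReal_sum_of_nonneg fun y _ => (J.dag y.task y.job).wt_nonneg _]
    refine Finset.sum_le_sum fun y _ => ?_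
    rw [lintegral_indicator_one (hrun.measurable y),
      Measure.restrict_apply (hrun.measurable y)]
    refine le_trans (measure_mono ?_) (hrun.service_le y e)
    exact fun s hs => ⟨hs.2.2, hs.1⟩
  have hidle : volume (W \ E) ≤ ENNReal.ofReal (J.dag k j).critLen := by
    refine hrun.volume_unfinished_le_critLen hj (fun s hs => hrel.trans hs.1.1)
      (fun s hs j' hj' hlt => (hprev j' hj' hlt).mono hs.1.1) ?_ (fun s hs => hs.1.2) hunf
    intro s hs v hv
    by_contra hnot
    obtain ⟨hc, hle⟩ := hrun.dispatch s _ hv hnot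
    refine hs.2 ?_
    change (M : ENNReal) ≤ g s
    rw [hgY s fun y hy => hY y (hle y hy) (hN s hs.1 y hy (hle y hy)), hc]
  have hM' : (0 : ℝ) < M := by exact_mod_cast hM
  rw [hYsum] at hbusy
  set A := ∑ i ∈ Finset.Iic k, ∑ j' ∈ N i, (J.dag i j').work with hA
  have hA0 : 0 ≤ A := Finset.sum_nonneg fun i _ => Finset.sum_nonneg fun j' _ =>
    Finset.sum_nonneg fun v _ => (J.dag i j').wt_nonneg v
  have hbusy' : volume (W ∩ E) ≤ ENNReal.ofReal (A / M) := by
    rw [ENNReal.ofReal_div_of_pos hM', ENNReal.ofReal_natCast,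
      ENNReal.le_div_iff_mul_le (Or.inl (by exact_mod_cast hM.ne')) (Or.inl (by simp)), mul_comm]
    exact hbusy
  have hW : ENNReal.ofReal (e - r) ≤ ENNReal.ofReal ((J.dag k j).critLen + A / M) := by
    rw [ENNReal.ofReal_add (Dag.critLen_nonneg _) (by positivity), ← Real.volume_Ico]
    calc volume W = volume ((W \ E) ∪ (W ∩ E)) := by rw [Set.sdiff_union_inter]
      _ ≤ _ := (measure_union_le _ _).trans (add_le_add hidle hbusy')
  exact (ENNReal.ofReal_le_ofReal_iff
    (add_nonneg (Dag.critLen_nonneg _) (by positivity))).1 hW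

/-- The time-demand bound: if the higher-priority tasks are schedulable, the earlier jobs of task
`k` are finished when a job of it is released, and this job is not finished `t` time units after
its release, then `t` is at most the demand of a window of length `t`. -/
theorem le_demand_of_not_jobFinished (hrun : IsGlobalFixedPriority M run) (hM : 0 < M)
    {k : Fin n} (hhp : ∀ i, i < k → Schedulable τ M i) {j : ℕ} (hj : j ∈ J.jobs k)
    (hprev : ∀ j' ∈ J.jobs k, j' < j → JobFinished run k j' (J.release k j)) {t : ℝ}
    (ht : 0 ≤ t) (hunf : ¬ JobFinished run k j (J.release k j + t)) :
    t ≤ (τ k).Psi +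
      ((τ k).C + ∑ i ∈ Finset.Iio k, ((⌈t / (τ i).T⌉₊ : ℝ) + 1) * (τ i).C) / M := by
  classical
  -- A higher-priority job running in the window is released after `r - T i`, having met its
  -- deadline. The open interval of length `t + T i` yields the extra job.
  set r := J.release k j with hr
  have hwin : ∀ i, ∃ F : Finset ℕ, (F : Set ℕ) = {m | m ∈ J.jobs i ∧
      r - (τ i).T < J.release i m ∧ J.release i m < r + t} ∧ F.card ≤ ⌈t / (τ i).T⌉₊ + 1 := by
    intro i
    have hT := (τ i).T_pos
    obtain ⟨F, hF, hc⟩ := card_le_ceil_of_separated (S := {m | m ∈ J.jobs i ∧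
      r - (τ i).T < J.release i m ∧ J.release i m < r + t}) (f := J.release i)
      (a := r - (τ i).T) (L := t + (τ i).T) hT
      (fun m hm m' hm' h => J.separation i m hm.1 m' hm'.1 h) (fun m hm => hm.2.1)
      (fun m hm => by linarith [hm.2.2])
    refine ⟨F, hF, hc.trans_eq ?_⟩
    rw [add_div, div_self hT.ne', Nat.ceil_add_one (by positivity)]
  choose F hF hcard using hwin
  have hmem : ∀ i, ∀ m ∈ F i, m ∈ J.jobs i := by
    intro i m hm
    have : m ∈ (F i : Set ℕ) := hm
    rw [hF i] at this
    exact this.1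
  let N : Fin n → Finset ℕ := fun i => if i = k then {j} else F i
  have hN : ∀ s ∈ Set.Ico r (r + t), ∀ y ∈ run s, y.task ≤ k → y.job ∈ N y.task := by
    rintro s hs ⟨i, m, v⟩ hy hle
    obtain ⟨hm, hrel, hpre, -, hnf⟩ := hrun.ready s _ hy
    dsimp only at hm hrel hpre hle ⊢
    rcases hle.lt_or_eq with hlt | rfl
    · have hfin := hhp i hlt J run hrun m hm v
      have hs' : s < J.release i m + (τ i).T := by
        by_contra! hcon
        exact hnf (hfin.mono hcon)
      have : m ∈ (F i : Set ℕ) := by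
        rw [hF i]
        exact ⟨hm, by linarith [hs.1], hrel.trans_lt hs.2⟩
      simpa [N, hlt.ne] using this
    · suffices m = j by simp [N, this]
      rcases lt_trichotomy m j with h | h | h
      · exact absurd ((hprev m hm h v).mono hs.1) hnf
      · exact h
      · exact absurd ((hpre j hj h).mono hs.2.le) hunf
  have hmain := hrun.volume_window_le hM hj le_rfl hprev hunf N hN
  rw [add_sub_cancel_left] at hmain
  have hk : (Finset.Iic k) = insert k (Finset.Iio k) := (Finset.Iio_insert k).symm
  rw [hk, Finset.sum_insert (by simp)] at hmain
  have hNk : N k = {j} := by simp [N]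
  rw [hNk, Finset.sum_singleton] at hmain
  have hdag := J.dag_mem k j hj
  refine hmain.trans (add_le_add ((τ k).critLen_le _ hdag) ?_)
  gcongr with i hi
  · exact (τ k).work_le _ hdag
  · have hNi : N i = F i := by simp [N, (Finset.mem_Iio.1 hi).ne]
    rw [hNi]
    calc ∑ m ∈ F i, (J.dag i m).work ≤ (F i).card • (τ i).C :=
          Finset.sum_le_card_nsmul _ _ _ fun m hm =>
            (τ i).work_le _ (J.dag_mem i m (hmem i m hm))
      _ ≤ ((⌈t / (τ i).T⌉₊ : ℝ) + 1) * (τ i).C := by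
          rw [nsmul_eq_mul]
          exact mul_le_mul_of_nonneg_right (by exact_mod_cast hcard i) (τ i).C_nonneg

end IsGlobalFixedPriority

end Scheduling

/-! ### From time demand to utilization -/

/-- If every `t j` is at most `A` plus the sum of `u i * t i` over the smaller `t i`, then these
bounds multiply up. -/
theorem add_sum_mul_le_mul_prod {ι : Type*} (s : Finset ι) (u t : ι → ℝ)
    {A : ℝ} (hu : ∀ i ∈ s, 0 ≤ u i) (ht : ∀ i ∈ s, 0 ≤ t i)
    (h : ∀ j ∈ s, t j ≤ A + ∑ i ∈ s with t i < t j, u i * t i) :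
    A + ∑ i ∈ s, u i * t i ≤ A * ∏ i ∈ s, (u i + 1) := by
  classical
  -- Removing the largest `t a` leaves the other hypotheses intact, as `a` is in none of their sums.
  induction s using Finset.induction_on_max_value t with
  | empty => simp
  | insert a s has hmax ih =>
    have hs := ih (fun i hi => hu i (Finset.mem_insert_of_mem hi))
      (fun i hi => ht i (Finset.mem_insert_of_mem hi)) fun j hj => by
        have := h j (Finset.mem_insert_of_mem hj)
        rwa [Finset.filter_insert, if_neg (hmax j hj).not_gt] at this
    have hua := hu a (Finset.mem_insert_self a s)
    have hta : t a ≤ A + ∑ i ∈ s, u i * t i := by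
      have := h a (Finset.mem_insert_self a s)
      rw [Finset.filter_insert, if_neg (lt_irrefl _)] at this
      refine this.trans (add_le_add le_rfl ?_)
      exact Finset.sum_le_sum_of_subset_of_nonneg (Finset.filter_subset _ _) fun i hi _ =>
        mul_nonneg (hu i (Finset.mem_insert_of_mem hi)) (ht i (Finset.mem_insert_of_mem hi))
    rw [Finset.sum_insert has, Finset.prod_insert has]
    calc A + (u a * t a + ∑ i ∈ s, u i * t i)
        = (A + ∑ i ∈ s, u i * t i) + u a * t a := by ring
      _ ≤ (A + ∑ i ∈ s, u i * t i) + u a * (A + ∑ i ∈ s, u i * t i) := by gcongr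
      _ = (A + ∑ i ∈ s, u i * t i) * (u a + 1) := by ring
      _ ≤ (A * ∏ i ∈ s, (u i + 1)) * (u a + 1) := by gcongr
      _ = A * ((u a + 1) * ∏ i ∈ s, (u i + 1)) := by ring

/-- A utilization bound from a time-demand bound: if the demand `x + ∑ (⌈t / T i⌉ + 1) * T i * u i`
of every window of length `t ≤ D` is at least `t`, then the utilizations `u i` are large. -/
theorem three_mul_le_of_forall_le_demand {ι : Type*} (s : Finset ι) (u T : ι → ℝ) {x D : ℝ}
    (hu : ∀ i ∈ s, 0 ≤ u i) (hT : ∀ i ∈ s, 0 < T i) (hTD : ∀ i ∈ s, T i ≤ D) (hD : 0 < D)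
    (h : ∀ t, 0 ≤ t → t ≤ D → t ≤ x + ∑ i ∈ s, ((⌈t / T i⌉₊ : ℝ) + 1) * T i * u i)
    (hP : 2 * ∏ i ∈ s, (u i + 1) ≤ 3) :
    3 * D ≤ (x + 2 * D) * ∏ i ∈ s, (u i + 1) := by
  -- The last multiple of `T i` up to `D`. Since `T i ≤ p i`, the demand of `i` is at most `2 * u i
  -- * p i` up to time `p i`, and `3 * u i * p i` up to `D`.
  let p : ι → ℝ := fun i => ⌊D / T i⌋₊ * T i
  have hp0 : ∀ i ∈ s, 0 ≤ p i := fun i hi => mul_nonneg (Nat.cast_nonneg _) (hT i hi).le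
  have hpD : ∀ i ∈ s, p i ≤ D := fun i hi =>
    (le_div_iff₀ (hT i hi)).1 (Nat.floor_le (div_nonneg hD.le (hT i hi).le))
  have hTp : ∀ i ∈ s, T i ≤ p i := by
    intro i hi
    have : 1 ≤ ⌊D / T i⌋₊ := Nat.le_floor (by
      rw [Nat.cast_one, le_div_iff₀ (hT i hi), one_mul]; exact hTD i hi)
    exact le_mul_of_one_le_left (hT i hi).le (by exact_mod_cast this)
  have hlate : ∀ i ∈ s, ∀ t, t ≤ D → ((⌈t / T i⌉₊ : ℝ) + 1) * T i * u i ≤ 3 * (u i * p i) := by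
    intro i hi t ht
    have h1 : ⌈t / T i⌉₊ ≤ ⌊D / T i⌋₊ + 1 :=
      (Nat.ceil_mono (div_le_div_of_nonneg_right ht (hT i hi).le)).trans (Nat.ceil_le_floor_add_one _)
    have h2 : (⌈t / T i⌉₊ : ℝ) ≤ ⌊D / T i⌋₊ + 1 := by exact_mod_cast h1
    have h3 : ((⌈t / T i⌉₊ : ℝ) + 1) * T i ≤ 3 * p i := by
      calc ((⌈t / T i⌉₊ : ℝ) + 1) * T i ≤ (⌊D / T i⌋₊ + 1 + 1) * T i :=
            mul_le_mul_of_nonneg_right (by linarith) (hT i hi).le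
        _ = p i + 2 * T i := by simp only [p]; ring
        _ ≤ 3 * p i := by linarith [hTp i hi]
    nlinarith [mul_le_mul_of_nonneg_right h3 (hu i hi)]
  have hearly : ∀ i ∈ s, ∀ t, t ≤ p i → ((⌈t / T i⌉₊ : ℝ) + 1) * T i * u i ≤ 2 * (u i * p i) := by
    intro i hi t ht
    have h1 : ⌈t / T i⌉₊ ≤ ⌊D / T i⌋₊ := Nat.ceil_le.2 ((div_le_iff₀ (hT i hi)).2 ht)
    have h2 : (⌈t / T i⌉₊ : ℝ) ≤ ⌊D / T i⌋₊ := by exact_mod_cast h1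
    have h3 : ((⌈t / T i⌉₊ : ℝ) + 1) * T i ≤ 2 * p i := by
      calc ((⌈t / T i⌉₊ : ℝ) + 1) * T i ≤ (⌊D / T i⌋₊ + 1) * T i :=
            mul_le_mul_of_nonneg_right (by linarith) (hT i hi).le
        _ = p i + T i := by simp only [p]; ring
        _ ≤ 2 * p i := by linarith [hTp i hi]
    nlinarith [mul_le_mul_of_nonneg_right h3 (hu i hi)]
  -- The constant absorbs the doubled sum; only the third copy depends on the order of the `p i`.
  have hprod := add_sum_mul_le_mul_prod s u p (A := x + 2 * ∑ i ∈ s, u i * p i) hu hp0 (by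
    intro j hj
    refine (h (p j) (hp0 j hj) (hpD j hj)).trans ?_
    rw [add_assoc, Finset.mul_sum, Finset.sum_filter, ← Finset.sum_add_distrib]
    gcongr with i hi
    split_ifs with hij
    · linarith [hlate i hi (p j) (hpD j hj)]
    · linarith [hearly i hi (p j) (not_lt.1 hij)])
  have hDle : D ≤ x + 3 * ∑ i ∈ s, u i * p i := by
    refine (h D hD.le le_rfl).trans ?_
    rw [Finset.mul_sum]
    exact add_le_add le_rfl (Finset.sum_le_sum fun i hi => hlate i hi D le_rfl)
  -- With `Y = x + 3 * ∑ u i * p i`, `hprod` reads `(3 - 2 * ∏) * Y ≤ x * ∏`, and `hP` allows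
  -- replacing `Y` by `D`.
  nlinarith [mul_le_mul_of_nonneg_left hDle (sub_nonneg.2 hP)]

/-- The hyperbolic form of the utilization test. -/
theorem schedulable_of_mul_prod_le {n : ℕ} (τ : Fin n → DagTask) (hRM : IsRateMonotonic τ)
    (M : ℕ) (hM : 0 < M) (k : Fin n) (hhp : ∀ i, i < k → Schedulable τ M i)
    (h : ((τ k).Psi / (τ k).T + 2) * ∏ j ∈ Finset.Iic k, ((τ j).U / (M : ℝ) + 1) ≤ 3) :
    Schedulable τ M k := by
  intro J run hrun j
  induction j using Nat.strong_induction_on with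
  | _ j ih =>
  intro hj
  by_contra hunf
  have hT := (τ k).T_pos
  have hM' : (0 : ℝ) < M := by exact_mod_cast hM
  have hprev : ∀ j' ∈ J.jobs k, j' < j → JobFinished run k j' (J.release k j) :=
    fun j' hj' hlt => (ih j' hlt hj').mono (J.separation k j' hj' j hj hlt)
  obtain ⟨v, hv⟩ := not_forall.1 hunf
  -- Zero-weight subtasks are always finished. Positivity of `C` makes `hstrict` strict, as the
  -- non-strict test requires.
  have hCpos : 0 < (τ k).C := by
    have h1 : 0 < (J.dag k j).wt v := by
      by_contra! hcon
      exact hv (by simp [Finished, ENNReal.ofReal_of_nonpos hcon])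
    have h2 : (J.dag k j).wt v ≤ (J.dag k j).work :=
      Finset.single_le_sum (fun w _ => (J.dag k j).wt_nonneg w) (Finset.mem_univ v)
    linarith [(τ k).work_le _ (J.dag_mem k j hj)]
  have hu : ∀ i ∈ Finset.Iio k, 0 ≤ (τ i).U / (M : ℝ) := fun i _ =>
    div_nonneg (τ i).U_nonneg hM'.le
  set P := ∏ i ∈ Finset.Iio k, ((τ i).U / (M : ℝ) + 1) with hPdef
  have hP : 0 < P := Finset.prod_pos fun i hi => by linarith [hu i hi]
  rw [← Finset.Iio_insert k, Finset.prod_insert (by simp)] at h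
  have hX : 0 ≤ (τ k).Psi / (τ k).T := div_nonneg (τ k).Psi_nonneg hT.le
  have hw : 0 < (τ k).U / (M : ℝ) := div_pos (div_pos hCpos hT) hM'
  set X := (τ k).Psi / (τ k).T with hXdef
  set w := (τ k).U / (M : ℝ) with hwdef
  have hPsi : (τ k).Psi = X * (τ k).T := by rw [hXdef]; field_simp
  have hC : (τ k).C / M = w * (τ k).T := by rw [hwdef, DagTask.U]; field_simp
  have hstrict : (X + w + 2) * P < 3 := by
    have : (X + w + 2) * P < (X + 2) * ((w + 1) * P) := by
      have : 0 < w * (X + 1) * P := by positivity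
      nlinarith
    linarith
  have hconc := three_mul_le_of_forall_le_demand (Finset.Iio k) (fun i => (τ i).U / (M : ℝ))
    (fun i => (τ i).T) (x := (X + w) * (τ k).T) (D := (τ k).T) hu (fun i _ => (τ i).T_pos)
    (fun i hi => hRM i k (Finset.mem_Iio.1 hi).le) hT (by
      intro t ht0 htD
      refine (hrun.le_demand_of_not_jobFinished hM hhp hj hprev ht0
        fun hf => hunf (hf.mono (by linarith))).trans_eq ?_
      rw [add_div, hPsi, hC, Finset.sum_div, add_mul, add_assoc]
      congr 2
      refine Finset.sum_congr rfl fun i _ => ?_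
      have := (τ i).T_pos
      rw [DagTask.U]
      field_simp) (by nlinarith [mul_nonneg (add_nonneg hX hw.le) hP.le])
  nlinarith [mul_lt_mul_of_pos_right hstrict hT]

theorem theorem4 {n : ℕ} (τ : Fin n → DagTask) (hRM : IsRateMonotonic τ)
    (M : ℕ) (hM : 0 < M) (k : Fin n)
    (hhp : ∀ i, i < k → Schedulable τ M i)
    (h : ((τ k).Psi / (τ k).T + 2) * ∏ j ∈ Finset.Iic k, ((τ j).U / (M : ℝ) + 1) ≤ 3 ∨
      ∑ j ∈ Finset.Iic k, (τ j).U / (M : ℝ) ≤ Real.log (3 / ((τ k).Psi / (τ k).T + 2))) :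
    Schedulable τ M k := by
  refine schedulable_of_mul_prod_le τ hRM M hM k hhp (h.elim id fun hsum => ?_)
  have hX : 0 < (τ k).Psi / (τ k).T + 2 := by
    linarith [div_nonneg (τ k).Psi_nonneg (τ k).T_pos.le]
  rw [mul_comm, ← le_div_iff₀ hX]
  calc ∏ j ∈ Finset.Iic k, ((τ j).U / (M : ℝ) + 1)
      ≤ ∏ j ∈ Finset.Iic k, Real.exp ((τ j).U / (M : ℝ)) :=
        Finset.prod_le_prod
          (fun i _ => by linarith [div_nonneg (τ i).U_nonneg (Nat.cast_nonneg (α := ℝ) M)])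
          (fun i _ => Real.add_one_le_exp _)
    _ = Real.exp (∑ j ∈ Finset.Iic k, (τ j).U / (M : ℝ)) := (Real.exp_sum _ _).symm
    _ ≤ 3 / ((τ k).Psi / (τ k).T + 2) := by
        rw [← Real.le_log_iff_exp_le (by positivity)]
        exact hsum
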